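/- All graphs are finite and simple and are considered up to isomorphism. A drawing of a graph maps the vertices to distinct points of the plane and each edge to a simple Jordan arc between its end vertices that contains no other vertex; it is 1-planar if each edge is crossed at most once. Uncrossed edges are called black and crossed edges red. A graph with $n\ge 3$ vertices is optimal 1-planar if it has a 1-planar drawing and exactly $4n-8$ edges. In a given 1-planar drawing, a kite $(a,b,c,d)$ consists of black edges $ab,bc,cd,da$ and two red edges $ac$, $bd$ that cross each other. The reduction system consists of the following two rules. A rule may be applied to an optimal 1-planar graph $G$ using any 1-planar drawing of $G$, and only if the resulting graph is again optimal 1-planar. * $SR(x\mapsto x_4)$: Let $x$ be a vertex of degree $6$ with neighbours $x_1,\dots,x_6$ such that $(x,x_1,x_2,x_3)$, $(x,x_3,x_4,x_5)$, $(x,x_5,x_6,x_1)$ are kites, let $x_3$ and $x_5$ have degree $\ne 6$, and let $x_4$ be adjacent to none of $x_1,x_2,x_6$. Remove $x$ and the edge $x_3x_5$, and add the edges $x_1x_4$, $x_2x_4$, $x_6x_4$. * $CR(x_1,x_2,x_3,x_4)$: Let $x_1,x_2,x_3,x_4$ be vertices of degree $6$ and $v_1,v_2,v_3,v_4$ four further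 vertices such that $(x_1,x_2,x_3,x_4)$ and $(x_i,x_{i+1},v_{i+1},v_i)$, $i=1,\dots,4$ (indices modulo $4$), are kites, let all $v_i$ have degree $\ne 6$, and let neither $v_1v_3$ nor $v_2v_4$ be an edge. Remove $x_1,x_2,x_3,x_4$ and add the edges $v_1v_3$ and $v_2v_4$. Write $G\to^* H$ if $H$ is obtained from $G$ by finitely many (possibly zero) applications of the rules, and call a graph irreducible if no rule applies to it. The system is confluent on optimal 1-planar graphs if, for every optimal 1-planar graph $G$, $G\to^*U$ and $G\to^*W$ imply that $U\to^*Z$ and $W\to^*Z$ for some $Z$. For $k\ge 3$ the extended wheel graph $XW_{2k}$ has two non-adjacent poles and vertices $v_1,\dots,v_{2k}$; both poles are adjacent to all $v_i$, and $v_i$ is adjacent to $v_{i\pm1}$ and $v_{i\pm2}$ (indices modulo $2k$). Let $G_{17}$ be the graph on the vertices $a,b,c,d,g,h,i,p,q,r,s,t,u,v,w,y,z$ in which two distinct vertices are adjacent if and only if they occur together in one of the quadruples $pcda$, $pagb$, $pbws$, $psrt$, $ptic$, $hicd$, $hdag$, $hgqi$, $qwsr$, $qrti$, $uvyz$, $gbvu$,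 $bwyv$, $wqzy$, $qguz$. **Corollary.** The reduction system with the rules $SR$ and $CR$ is not confluent on optimal 1-planar graphs. More precisely, $G_{17}$, $XW_{10}$ and $XW_6$ are optimal 1-planar, $G_{17}\to^* XW_{10}$ and $G_{17}\to^* XW_6$, and both $XW_{10}$ and $XW_6$ are irreducible. -/

import Mathlib

namespace OptimalOnePlanar

/-! ### Drawings and optimal 1-planar graphs -/

/-- A drawing of a graph in the plane: vertices are distinct points, every edge is a simple
Jordan arc between its two end vertices, and an edge passes through no other vertex.
Only the values of `arc` at the edges of `G` are relevant. -/
structure Drawing {V : Type} (G : SimpleGraph V) where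
  point : V → ℝ × ℝ
  arc : Sym2 V → Set (ℝ × ℝ)
  point_injective : Function.Injective point
  arc_simple : ∀ u v, G.Adj u v →
    ∃ γ : Path (point u) (point v), Function.Injective γ ∧ Set.range γ = arc s(u, v)
  vertex_of_mem : ∀ e ∈ G.edgeSet, ∀ w, point w ∈ arc e → w ∈ e

namespace Drawing

variable {V : Type} {G : SimpleGraph V}

/-- The distinct edges `e` and `f` cross at `P`: a common point of both that is not a vertex. -/
def CrossAt (D : Drawing G) (e f : Sym2 V) (P : ℝ × ℝ) : Prop :=
  e ∈ G.edgeSet ∧ f ∈ G.edgeSet ∧ e ≠ f ∧ P ∈ D.arc e ∧ P ∈ D.arc f ∧ P ∉ Set.range D.point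

/-- Every edge is crossed at most once (by at most one edge, at most one time). -/
def IsOnePlanar (D : Drawing G) : Prop :=
  ∀ e f f' P P', D.CrossAt e f P → D.CrossAt e f' P' → f = f' ∧ P = P'

/-- The pair `e`, `f` is a pair of crossing (red) edges. -/
def Crosses (D : Drawing G) (e f : Sym2 V) : Prop :=
  ∃ P, D.CrossAt e f P

/-- `e` is a planar (black) edge: an edge that is not crossed. -/
def Black (D : Drawing G) (e : Sym2 V) : Prop :=
  e ∈ G.edgeSet ∧ ∀ f, ¬ D.Crosses e f

/-- `(a, b, c, d)` is drawn as a kite: a cycle of black edges whose two diagonals are red edges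
that cross each other. In a 1-planar drawing of a graph with `4n - 8` edges the crossing lies in a
face of the black skeleton bounded by this cycle, so no vertex lies inside the kite. -/
def Kite (D : Drawing G) (a b c d : V) : Prop :=
  D.Black s(a, b) ∧ D.Black s(b, c) ∧ D.Black s(c, d) ∧ D.Black s(d, a) ∧
    D.Crosses s(a, c) s(b, d)

end Drawing

/-- Finite simple graphs. -/
structure FinGraph where
  V : Type
  finite : Finite V
  graph : SimpleGraph V

/-- An optimal 1-planar graph: a 1-planar graph with `n ≥ 3` vertices and `4n - 8` edges. -/
def IsOptimal (G : FinGraph) : Prop :=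
  3 ≤ Nat.card G.V ∧ G.graph.edgeSet.ncard + 8 = 4 * Nat.card G.V ∧
    ∃ D : Drawing G.graph, D.IsOnePlanar

/-- Number of neighbours of a vertex. -/
noncomputable def deg {V : Type} (G : SimpleGraph V) (v : V) : ℕ :=
  (G.neighborSet v).ncard

/-! ### The reduction `SR(x ↦ x₄)` -/

/-- In the drawing `D`, the crossed star matches the candidate `x` and its neighbours, which are
`x₁, …, x₆` in circular order; `x₁, x₃, x₅` are the black and `x₂, x₄, x₆` the red neighbours. -/
structure SRMatch {V : Type} {G : SimpleGraph V} (D : Drawing G)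
    (x x₁ x₂ x₃ x₄ x₅ x₆ : V) : Prop where
  distinct : [x, x₁, x₂, x₃, x₄, x₅, x₆].Nodup
  candidate : deg G x = 6
  kite₂ : D.Kite x x₁ x₂ x₃
  kite₄ : D.Kite x x₃ x₄ x₅
  kite₆ : D.Kite x x₅ x₆ x₁

/-- `SR(x ↦ x₄)` has neither a blocking vertex, nor a blocking red edge, nor a blocking
black edge. -/
def SRUnblocked {V : Type} (G : SimpleGraph V) (x₁ x₂ x₃ x₄ x₅ x₆ : V) : Prop :=
  deg G x₃ ≠ 6 ∧ deg G x₅ ≠ 6 ∧ ¬ G.Adj x₂ x₄ ∧ ¬ G.Adj x₆ x₄ ∧ ¬ G.Adj x₁ x₄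

/-- The graph after `SR(x ↦ x₄)`, the merging of `x` into `x₄`: the vertex `x` and the edge
`x₃x₅` are removed and the edges `x₁x₄`, `x₂x₄`, `x₆x₄` are added. -/
def srResult {V : Type} (G : SimpleGraph V) (x x₁ x₂ x₃ x₄ x₅ x₆ : V) :
    SimpleGraph ({v | v ≠ x} : Set V) :=
  (G.deleteEdges {s(x₃, x₅)} ⊔
    SimpleGraph.fromEdgeSet {s(x₁, x₄), s(x₂, x₄), s(x₆, x₄)}).induce {v | v ≠ x}

/-! ### The reduction `CR(x₁, x₂, x₃, x₄)` -/

/-- In the drawing `D`, the crossed cube with inner cycle `x₁, x₂, x₃, x₄` and outer cycle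
`v₁, v₂, v₃, v₄` matches a subgraph of `G`, where the inner vertices are candidates. -/
structure CRMatch {V : Type} {G : SimpleGraph V} (D : Drawing G)
    (x₁ x₂ x₃ x₄ v₁ v₂ v₃ v₄ : V) : Prop where
  distinct : [x₁, x₂, x₃, x₄, v₁, v₂, v₃, v₄].Nodup
  candidate₁ : deg G x₁ = 6
  candidate₂ : deg G x₂ = 6
  candidate₃ : deg G x₃ = 6
  candidate₄ : deg G x₄ = 6
  kite_inner : D.Kite x₁ x₂ x₃ x₄
  kite₁₂ : D.Kite x₁ x₂ v₂ v₁
  kite₂₃ : D.Kite x₂ x₃ v₃ v₂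
  kite₃₄ : D.Kite x₃ x₄ v₄ v₃
  kite₄₁ : D.Kite x₄ x₁ v₁ v₄

/-- `CR` has neither a blocking vertex nor a blocking red edge. -/
def CRUnblocked {V : Type} (G : SimpleGraph V) (v₁ v₂ v₃ v₄ : V) : Prop :=
  deg G v₁ ≠ 6 ∧ deg G v₂ ≠ 6 ∧ deg G v₃ ≠ 6 ∧ deg G v₄ ≠ 6 ∧
    ¬ G.Adj v₁ v₃ ∧ ¬ G.Adj v₂ v₄

/-- The graph after `CR(x₁, x₂, x₃, x₄)`: the inner vertices are removed and the pair of edges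
`v₁v₃`, `v₂v₄` is added. -/
def crResult {V : Type} (G : SimpleGraph V) (x₁ x₂ x₃ x₄ v₁ v₂ v₃ v₄ : V) :
    SimpleGraph ({v | v ≠ x₁ ∧ v ≠ x₂ ∧ v ≠ x₃ ∧ v ≠ x₄} : Set V) :=
  (G ⊔ SimpleGraph.fromEdgeSet {s(v₁, v₃), s(v₂, v₄)}).induce
    {v | v ≠ x₁ ∧ v ≠ x₂ ∧ v ≠ x₃ ∧ v ≠ x₄}

/-! ### The reduction system -/

/-- One feasible application of `SR` to `G` yields `H`, up to isomorphism. -/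
def SRStep (G H : FinGraph) : Prop :=
  IsOptimal G ∧ IsOptimal H ∧
    ∃ D : Drawing G.graph, D.IsOnePlanar ∧ ∃ x x₁ x₂ x₃ x₄ x₅ x₆ : G.V,
      SRMatch D x x₁ x₂ x₃ x₄ x₅ x₆ ∧ SRUnblocked G.graph x₁ x₂ x₃ x₄ x₅ x₆ ∧
      Nonempty (srResult G.graph x x₁ x₂ x₃ x₄ x₅ x₆ ≃g H.graph)

/-- One feasible application of `CR` to `G` yields `H`, up to isomorphism. -/
def CRStep (G H : FinGraph) : Prop :=
  IsOptimal G ∧ IsOptimal H ∧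
    ∃ D : Drawing G.graph, D.IsOnePlanar ∧ ∃ x₁ x₂ x₃ x₄ v₁ v₂ v₃ v₄ : G.V,
      CRMatch D x₁ x₂ x₃ x₄ v₁ v₂ v₃ v₄ ∧ CRUnblocked G.graph v₁ v₂ v₃ v₄ ∧
      Nonempty (crResult G.graph x₁ x₂ x₃ x₄ v₁ v₂ v₃ v₄ ≃g H.graph)

/-- One step of the reduction system with the rules `SR` and `CR`. -/
def Step (G H : FinGraph) : Prop :=
  SRStep G H ∨ CRStep G H

/-- `G →* H`: finitely many (possibly no) steps lead from `G` to a graph isomorphic to `H`. -/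
def Reduces (G H : FinGraph) : Prop :=
  ∃ K : FinGraph, Relation.ReflTransGen Step G K ∧ Nonempty (K.graph ≃g H.graph)

/-- No rule applies to `G`. -/
def IsIrreducible (G : FinGraph) : Prop :=
  ∀ H, ¬ Step G H

/-- Confluence of the reduction system on optimal 1-planar graphs; graphs are considered up to
isomorphism. -/
def IsConfluent : Prop :=
  ∀ G U W : FinGraph, IsOptimal G → Reduces G U → Reduces G W →
    ∃ Z : FinGraph, Reduces U Z ∧ Reduces W Z

/-! ### The graphs `XW₂ₖ` and `G₁₇` -/

/-- The relation that generates the edges of the extended wheel graph: both poles are joined to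
all vertices `v₀, …, v₂ₖ₋₁` of the cycle, and `vᵢ` is joined to `vᵢ₊₁` and `vᵢ₊₂`. -/
def wheelRel (k : ℕ) : Bool ⊕ Fin (2 * k) → Bool ⊕ Fin (2 * k) → Prop
  | .inl _, .inr _ => True
  | .inr i, .inr j => j.val = (i.val + 1) % (2 * k) ∨ j.val = (i.val + 2) % (2 * k)
  | _, _ => False

/-- The extended wheel graph `XW₂ₖ` with two poles (`Sum.inl`) and a cycle of `2k` vertices. -/
def extendedWheel (k : ℕ) : SimpleGraph (Bool ⊕ Fin (2 * k)) :=
  SimpleGraph.fromRel (wheelRel k)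

/-- `XW k` is the graph `XW₂ₖ`. -/
abbrev XW (k : ℕ) : FinGraph := ⟨Bool ⊕ Fin (2 * k), inferInstance, extendedWheel k⟩

/-- The vertices of `G₁₇`. -/
inductive V17 : Type
  | a | b | c | d | g | h | i | p | q | r | s | t | u | v | w | y | z
  deriving DecidableEq

instance : Fintype V17 where
  elems := {.a, .b, .c, .d, .g, .h, .i, .p, .q, .r, .s, .t, .u, .v, .w, .y, .z}
  complete n := by cases n <;> decide

open V17 in
/-- The quadrangular faces of the planar skeleton of `G₁₇`. -/
def faces17 : List (List V17) :=
  [[p, c, d, a], [p, a, g, b], [p, b, w, s], [p, s, r, t], [p, t, i, c],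
   [h, i, c, d], [h, d, a, g], [h, g, q, i], [q, w, s, r], [q, r, t, i],
   [u, v, y, z], [g, b, v, u], [b, w, y, v], [w, q, z, y], [q, g, u, z]]

/-- The graph `G₁₇`: each face of the skeleton carries a kite, so two distinct vertices are
adjacent iff they lie on a common face. -/
def graph17 : SimpleGraph V17 :=
  SimpleGraph.fromRel fun m n => ∃ F ∈ faces17, m ∈ F ∧ n ∈ F

/-- `G₁₇` as an object of the reduction system. -/
abbrev G17 : FinGraph := ⟨V17, inferInstance, graph17⟩

end OptimalOnePlanar

/-! Two reductions of $G_{17}$ share the first step, the merging of $h$ into $q$, and then diverge.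
Removing the cube $u,v,y,z$ at once yields $XW_{10}$. Merging $a$, $d$, $c$, $g$ first and removing
the cube afterwards yields $XW_6$. Removing a cube costs each outer vertex three neighbours and
gains it one. Hence early removal lowers the degree of $g$ from 8 to 6, and $g$ then blocks the
merging of $a$ into $b$.

Both results are irreducible in every drawing, for reasons of degree and adjacency alone, so no
classification of drawings is needed. In $XW_6$ all degrees are 6, and both rules need vertices of
other degree. In $XW_{10}$ only the poles have degree other than 6, while both rules need two
adjacent vertices of this kind. A common reduct would thus make the two graphs isomorphic, but they
have 12 and 8 vertices.

The positive claims rest on explicit drawings. All graphs are drawn on the same 17 grid points with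
edges of at most one bend. Incidences and crossings reduce to signs of areas of lattice triangles,
which the kernel evaluates (`Sketch.valid_of_check`). `Sketch.Valid.drawing` turns such data into a
topological drawing. `IsModel` discards deleted vertices, which stay behind as isolated points.
`srStep_of_applies` and `crStep_of_applies` convert finite tests into reduction steps. -/

namespace OptimalOnePlanar

/-! ### Segments between grid points -/

/-- Twice the signed area of the triangle `A B C`. -/
def signedArea (A B C : ℝ × ℝ) : ℝ :=
  (B.1 - A.1) * (C.2 - A.2) - (B.2 - A.2) * (C.1 - A.1)

/-- The point of the plane with the given natural coordinates. -/
def gridPoint (A : ℕ × ℕ) : ℝ × ℝ := (A.1, A.2)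

/-- The grid points `A`, `B`, `C` form a counterclockwise triangle. -/
def ccw (A B C : ℕ × ℕ) : Bool :=
  decide (A.2 * B.1 + B.2 * C.1 + C.2 * A.1 < A.1 * B.2 + B.1 * C.2 + C.1 * A.2)

/-- The segment between two grid points. -/
def seg (s : (ℕ × ℕ) × (ℕ × ℕ)) : Set (ℝ × ℝ) := segment ℝ (gridPoint s.1) (gridPoint s.2)

/-- Both ends of `t` lie strictly on the same side of the line through `s`. -/
def sameSide (s t : (ℕ × ℕ) × (ℕ × ℕ)) : Bool :=
  (ccw s.1 s.2 t.1 && ccw s.1 s.2 t.2) || (ccw s.2 s.1 t.1 && ccw s.2 s.1 t.2)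

/-- The ends of `t` lie strictly on opposite sides of the line through `s`. -/
def oppositeSides (s t : (ℕ × ℕ) × (ℕ × ℕ)) : Bool :=
  (ccw s.1 s.2 t.1 && ccw s.2 s.1 t.2) || (ccw s.2 s.1 t.1 && ccw s.1 s.2 t.2)

/-- One of two segments lies strictly on one side of the line through the other one. -/
def apart (s t : (ℕ × ℕ) × (ℕ × ℕ)) : Bool := sameSide s t || sameSide t s

/-- Each of two segments properly crosses the line through the other one. -/
def properCross (s t : (ℕ × ℕ) × (ℕ × ℕ)) : Bool := oppositeSides s t && oppositeSides t s

/-- Two segments with the same first end and different directions. -/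
def hinged (s t : (ℕ × ℕ) × (ℕ × ℕ)) : Bool :=
  decide (s.1 = t.1) && (ccw s.1 s.2 t.2 || ccw s.1 t.2 s.2)

/-- A test which ensures that two segments have at most common ends in common. -/
def meetAtEnds (s t : (ℕ × ℕ) × (ℕ × ℕ)) : Bool :=
  apart s t || hinged s t || hinged s t.swap || hinged s.swap t || hinged s.swap t.swap

/-- Expanding the area and moving the negative terms across leaves a comparison of natural numbers,
which is cheap to decide. -/
theorem ccw_iff {A B C : ℕ × ℕ} :
    ccw A B C = true ↔ 0 < signedArea (gridPoint A) (gridPoint B) (gridPoint C) := by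
  have h : signedArea (gridPoint A) (gridPoint B) (gridPoint C) =
      ((A.1 * B.2 + B.1 * C.2 + C.1 * A.2 : ℕ) : ℝ) -
        ((A.2 * B.1 + B.2 * C.1 + C.2 * A.1 : ℕ) : ℝ) := by
    simp only [signedArea, gridPoint]; push_cast; ring
  rw [h, sub_pos, Nat.cast_lt, ccw, decide_eq_true_iff]

theorem gridPoint_injective : Function.Injective gridPoint := by
  rintro ⟨a, b⟩ ⟨c, d⟩ h
  simpa [gridPoint] using h

theorem seg_swap (s : (ℕ × ℕ) × (ℕ × ℕ)) : seg s.swap = seg s :=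
  segment_symm _ _ _

theorem signedArea_swap (A B C : ℝ × ℝ) : signedArea B A C = -signedArea A B C := by
  simp only [signedArea]; ring

theorem signedArea_rotate (A B C : ℝ × ℝ) : signedArea A C B = -signedArea A B C := by
  simp only [signedArea]; ring

/-- The area is affine in its third argument; all the separation and intersection tests below come
from this. -/
theorem signedArea_combo {A B C D : ℝ × ℝ} {a b : ℝ} (h : a + b = 1) :
    signedArea A B (a • C + b • D) = a * signedArea A B C + b * signedArea A B D := by
  obtain rfl : b = 1 - a := by linarith
  simp only [signedArea, Prod.fst_add, Prod.snd_add, Prod.smul_fst, Prod.smul_snd, smul_eq_mul]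
  ring

theorem signedArea_eq_zero_of_mem_segment {A B X : ℝ × ℝ} (h : X ∈ segment ℝ A B) :
    signedArea A B X = 0 := by
  obtain ⟨a, b, -, -, hab, rfl⟩ := h
  rw [signedArea_combo hab]
  simp only [signedArea]; ring

theorem signedArea_pos_of_mem_segment {A B C D X : ℝ × ℝ} (h : X ∈ segment ℝ C D)
    (hC : 0 < signedArea A B C) (hD : 0 < signedArea A B D) : 0 < signedArea A B X := by
  obtain ⟨a, b, ha, hb, hab, rfl⟩ := h
  rw [signedArea_combo hab]
  rcases ha.eq_or_lt with rfl | ha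
  · obtain rfl : b = 1 := by linarith
    simpa using hD
  · have := mul_pos ha hC
    have := mul_nonneg hb hD.le
    linarith

theorem disjoint_of_sameSide {s t : (ℕ × ℕ) × (ℕ × ℕ)} (h : sameSide s t = true) {X : ℝ × ℝ}
    (hs : X ∈ seg s) (ht : X ∈ seg t) : False := by
  have h0 := signedArea_eq_zero_of_mem_segment hs
  simp only [sameSide, Bool.or_eq_true, Bool.and_eq_true, ccw_iff] at h
  rcases h with ⟨h₁, h₂⟩ | ⟨h₁, h₂⟩
  · exact (signedArea_pos_of_mem_segment ht h₁ h₂).ne' h0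
  · have := signedArea_pos_of_mem_segment ht h₁ h₂
    rw [signedArea_swap, h0] at this
    simp at this

theorem disjoint_of_apart {s t : (ℕ × ℕ) × (ℕ × ℕ)} (h : apart s t = true) {X : ℝ × ℝ}
    (hs : X ∈ seg s) (ht : X ∈ seg t) : False := by
  rw [apart, Bool.or_eq_true] at h
  exact h.elim (disjoint_of_sameSide · hs ht) (disjoint_of_sameSide · ht hs)

/-- Two segments that are not parallel have at most one common point. -/
theorem eq_of_mem_segments {A B C D X Y : ℝ × ℝ} (hXs : X ∈ segment ℝ A B)
    (hXt : X ∈ segment ℝ C D) (hYs : Y ∈ segment ℝ A B) (hYt : Y ∈ segment ℝ C D)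
    (h : signedArea A B C ≠ signedArea A B D) : X = Y := by
  have h₁ := signedArea_eq_zero_of_mem_segment hXs
  have h₂ := signedArea_eq_zero_of_mem_segment hYs
  obtain ⟨a, b, -, -, hab, rfl⟩ := hXt
  obtain ⟨c, d, -, -, hcd, rfl⟩ := hYt
  rw [signedArea_combo hab] at h₁
  rw [signedArea_combo hcd] at h₂
  obtain rfl : b = 1 - a := by linarith
  obtain rfl : d = 1 - c := by linarith
  -- Along `C D` the area over `A B` is affine in the parameter and vanishes at both points; as it
  -- is not constant, the parameters agree.
  have : (a - c) * (signedArea A B C - signedArea A B D) = 0 := by linear_combination h₁ - h₂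
  rcases mul_eq_zero.1 this with h' | h'
  · rw [sub_eq_zero.1 h']
  · exact absurd (sub_eq_zero.1 h') h

/-- The shared first end is a common point, and non-parallel segments have no second one. -/
theorem eq_of_hinged {s t : (ℕ × ℕ) × (ℕ × ℕ)} (h : hinged s t = true) {X : ℝ × ℝ}
    (hs : X ∈ seg s) (ht : X ∈ seg t) : X = gridPoint s.1 ∧ s.1 = t.1 := by
  simp only [hinged, Bool.and_eq_true, Bool.or_eq_true, decide_eq_true_eq, ccw_iff] at h
  obtain ⟨h₁, h₂⟩ := h
  refine ⟨?_, h₁⟩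
  rw [signedArea_rotate _ (gridPoint s.2) (gridPoint t.2)] at h₂
  have h0 : signedArea (gridPoint s.1) (gridPoint s.2) (gridPoint t.1) = 0 :=
    signedArea_eq_zero_of_mem_segment (h₁ ▸ left_mem_segment ℝ _ _)
  refine eq_of_mem_segments hs ht (left_mem_segment ℝ _ _)
    (h₁ ▸ left_mem_segment ℝ _ _) ?_
  rw [h0]
  rcases h₂ with h₂ | h₂
  · exact h₂.ne
  · exact fun h => by simp [← h] at h₂

theorem ne_of_hinged {s t : (ℕ × ℕ) × (ℕ × ℕ)} (h : hinged s t = true) :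
    s.1 ≠ s.2 ∧ t.1 ≠ t.2 := by
  simp only [hinged, Bool.and_eq_true, Bool.or_eq_true, decide_eq_true_eq, ccw_iff,
    signedArea] at h
  obtain ⟨h₁, h₂⟩ := h
  constructor <;> intro h'
  · simp [← h'] at h₂
  · simp [h₁, ← h'] at h₂

theorem eq_end_of_meetAtEnds {s t : (ℕ × ℕ) × (ℕ × ℕ)} (h : meetAtEnds s t = true) {X : ℝ × ℝ}
    (hs : X ∈ seg s) (ht : X ∈ seg t) :
    ∃ A : ℕ × ℕ, X = gridPoint A ∧ (A = s.1 ∨ A = s.2) ∧ (A = t.1 ∨ A = t.2) := by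
  simp only [meetAtEnds, Bool.or_eq_true] at h
  have hs' := (seg_swap s).symm ▸ hs
  have ht' := (seg_swap t).symm ▸ ht
  rcases h with (((h | h) | h) | h) | h
  · exact (disjoint_of_apart h hs ht).elim
  · obtain ⟨h₁, h₂⟩ := eq_of_hinged h hs ht
    exact ⟨s.1, h₁, .inl rfl, .inl h₂⟩
  · obtain ⟨h₁, h₂⟩ := eq_of_hinged h hs ht'
    exact ⟨s.1, h₁, .inl rfl, .inr h₂⟩
  · obtain ⟨h₁, h₂⟩ := eq_of_hinged h hs' ht
    exact ⟨s.2, h₁, .inr rfl, .inl h₂⟩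
  · obtain ⟨h₁, h₂⟩ := eq_of_hinged h hs' ht'
    exact ⟨s.2, h₁, .inr rfl, .inr h₂⟩

theorem oppositeSides_iff {s t : (ℕ × ℕ) × (ℕ × ℕ)} : oppositeSides s t = true ↔
    signedArea (gridPoint s.1) (gridPoint s.2) (gridPoint t.1) *
      signedArea (gridPoint s.1) (gridPoint s.2) (gridPoint t.2) < 0 := by
  simp only [oppositeSides, Bool.or_eq_true, Bool.and_eq_true, ccw_iff,
    signedArea_swap (gridPoint s.1) (gridPoint s.2), Left.neg_pos_iff, mul_neg_iff]

theorem eq_of_properCross {s t : (ℕ × ℕ) × (ℕ × ℕ)} (h : properCross s t = true) {X Y : ℝ × ℝ}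
    (hXs : X ∈ seg s) (hXt : X ∈ seg t) (hYs : Y ∈ seg s) (hYt : Y ∈ seg t) : X = Y := by
  rw [properCross, Bool.and_eq_true, oppositeSides_iff] at h
  refine eq_of_mem_segments hXs hXt hYs hYt fun h' => ?_
  rw [h'] at h
  exact h.1.not_ge (mul_self_nonneg _)

theorem exists_of_properCross {s t : (ℕ × ℕ) × (ℕ × ℕ)} (h : properCross s t = true) :
    ∃ X, X ∈ seg s ∧ X ∈ seg t := by
  rw [properCross, Bool.and_eq_true, oppositeSides_iff, oppositeSides_iff] at h
  obtain ⟨h₁, h₂⟩ := h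
  simp only [seg]
  generalize gridPoint s.1 = A at *
  generalize gridPoint s.2 = B at *
  generalize gridPoint t.1 = C at *
  generalize gridPoint t.2 = D at *
  have key : ∀ {p q : ℝ}, p * q < 0 → p - q ≠ 0 ∧ 0 ≤ p / (p - q) ∧ 0 ≤ -q / (p - q) := by
    intro p q hpq
    rcases mul_neg_iff.1 hpq with ⟨hp, hq⟩ | ⟨hp, hq⟩
    · exact ⟨by linarith, div_nonneg hp.le (by linarith), div_nonneg (by linarith) (by linarith)⟩
    · exact ⟨by linarith, div_nonneg_of_nonpos hp.le (by linarith),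
        div_nonneg_of_nonpos (by linarith) (by linarith)⟩
  obtain ⟨n₁, p₁, q₁⟩ := key h₁
  obtain ⟨n₂, p₂, q₂⟩ := key h₂
  -- If the ends of a segment have areas `p`, `q` of opposite sign over the other line, the area
  -- vanishes at the point with weights `-q / (p - q)` and `p / (p - q)`. This describes the
  -- crossing point once on each segment.
  refine ⟨_, ⟨_, _, q₂, p₂, by field_simp; ring, rfl⟩, ⟨_, _, q₁, p₁, by field_simp; ring, ?_⟩⟩
  ext
  · simp only [Prod.fst_add, Prod.smul_fst, smul_eq_mul]
    field_simp
    simp only [signedArea]; ring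
  · simp only [Prod.snd_add, Prod.smul_snd, smul_eq_mul]
    field_simp
    simp only [signedArea]; ring

/-! ### Simple arcs -/

/-- `S` is a simple Jordan arc from `A` to `B`. -/
def IsSimpleArc (A B : ℝ × ℝ) (S : Set (ℝ × ℝ)) : Prop :=
  ∃ γ : Path A B, Function.Injective γ ∧ Set.range γ = S

theorem IsSimpleArc.symm {A B : ℝ × ℝ} {S : Set (ℝ × ℝ)} (h : IsSimpleArc A B S) :
    IsSimpleArc B A S := by
  obtain ⟨γ, hγ, rfl⟩ := h
  exact ⟨γ.symm, hγ.comp unitInterval.symm_bijective.injective, γ.symm_range⟩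

theorem isSimpleArc_segment {A B : ℝ × ℝ} (h : A ≠ B) : IsSimpleArc A B (segment ℝ A B) := by
  refine ⟨⟨⟨fun t => AffineMap.lineMap A B (t : ℝ), ?_⟩, ?_, ?_⟩, ?_, ?_⟩
  · exact (AffineMap.lineMap_continuous (R := ℝ)).comp continuous_subtype_val
  · simp
  · simp
  · intro s t hst
    exact Subtype.ext (AffineMap.lineMap_injective ℝ h hst)
  · rw [segment_eq_image_lineMap]
    ext X
    constructor
    · rintro ⟨t, rfl⟩
      exact ⟨t, t.2, rfl⟩
    · rintro ⟨t, ht, rfl⟩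
      exact ⟨⟨t, ht⟩, rfl⟩

theorem IsSimpleArc.union {A B C : ℝ × ℝ} {S T : Set (ℝ × ℝ)} (hS : IsSimpleArc A B S)
    (hT : IsSimpleArc B C T) (h : ∀ X ∈ S, X ∈ T → X = B) : IsSimpleArc A C (S ∪ T) := by
  obtain ⟨γ, hγ, rfl⟩ := hS
  obtain ⟨δ, hδ, rfl⟩ := hT
  refine ⟨γ.trans δ, ?_, Path.trans_range γ δ⟩
  -- A point reached in both halves must be `B`, which injectivity of `δ` places at the parameter
  -- 1/2 only.
  have cross : ∀ s t : unitInterval, (s : ℝ) ≤ 1 / 2 → ¬ (t : ℝ) ≤ 1 / 2 →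
      γ.trans δ s = γ.trans δ t → False := by
    intro s t hs ht hst
    rw [Path.trans_apply, Path.trans_apply, dif_pos hs, dif_neg ht] at hst
    have hB := h _ ⟨_, rfl⟩ ⟨_, hst.symm⟩
    rw [hst] at hB
    have := hδ (hB.trans δ.source.symm)
    have := congrArg Subtype.val this
    simp only [Set.Icc.coe_zero] at this
    rw [not_le] at ht
    linarith
  intro s t hst
  by_cases hs : (s : ℝ) ≤ 1 / 2 <;> by_cases ht : (t : ℝ) ≤ 1 / 2
  · rw [Path.trans_apply, Path.trans_apply, dif_pos hs, dif_pos ht] at hst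
    have := congrArg Subtype.val (hγ hst)
    exact Subtype.ext (by simpa using this)
  · exact (cross s t hs ht hst).elim
  · exact (cross t s ht hs hst.symm).elim
  · rw [Path.trans_apply, Path.trans_apply, dif_neg hs, dif_neg ht] at hst
    have := congrArg Subtype.val (hδ hst)
    exact Subtype.ext (by simpa using this)

/-! ### Polygonal drawings with at most one bend per edge -/

/-- Data for a drawing in which every edge is a segment or a union of two segments: the grid
points of the vertices, the bends of the (directed) edges, the black edges and the pairs of
crossing red edges. -/
structure Sketch (V : Type) where
  pos : V → ℕ × ℕ
  bend : V × V → Option (ℕ × ℕ)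
  black : List (V × V)
  red : List ((V × V) × (V × V))

namespace Sketch

variable {V : Type} (S : Sketch V)

/-- All edges, each with one direction. -/
def edges : List (V × V) := S.black ++ (S.red.map Prod.fst ++ S.red.map Prod.snd)

/-- The graph that is drawn. -/
def graph : SimpleGraph V := SimpleGraph.fromRel fun u v => (u, v) ∈ S.edges

/-- The segments of an edge. -/
def pieces (d : V × V) : List ((ℕ × ℕ) × (ℕ × ℕ)) :=
  match S.bend d with
  | none => [(S.pos d.1, S.pos d.2)]
  | some M => [(S.pos d.1, M), (M, S.pos d.2)]

/-- The union of the segments of an edge. -/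
def carrier (d : V × V) : Set (ℝ × ℝ) := {X | ∃ s ∈ S.pieces d, X ∈ seg s}

/-- The segments of two edges have at most common ends in common. -/
def meetOnlyAtEnds (d d' : V × V) : Bool :=
  (S.pieces d).all fun s => (S.pieces d').all fun t => meetAtEnds s t

/-- One segment of `d` crosses one segment of `d'`, and the other segments are disjoint. -/
def crossOnce (d d' : V × V) : Bool :=
  (S.pieces d).any fun s => (S.pieces d').any fun t => properCross s t &&
    (S.pieces d).all fun s₂ => (S.pieces d').all fun t₂ =>
      (decide (s₂ = s) && decide (t₂ = t)) || apart s₂ t₂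

/-- The conditions under which the data describe a 1-planar drawing. -/
structure Valid : Prop where
  pos_injective : ∀ u v, S.pos u = S.pos v → u = v
  nodup : (S.edges.map fun d => s(d.1, d.2)).Nodup
  loopless : ∀ d ∈ S.edges, d.1 ≠ d.2
  bend_simple : ∀ d ∈ S.edges,
    ((S.bend d).all fun M => hinged (M, S.pos d.1) (M, S.pos d.2)) = true
  avoids : ∀ d ∈ S.edges, ∀ w, w = d.1 ∨ w = d.2 ∨
    ((S.pieces d).all fun s => apart s (S.pos w, S.pos w)) = true
  uncrossed : S.edges.Pairwise fun d d' => (S.bend d = none ∨ S.bend d ≠ S.bend d') ∧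
    (S.meetOnlyAtEnds d d' = true ∨ (d, d') ∈ S.red ∨ (d', d) ∈ S.red)
  crossed : ∀ r ∈ S.red, S.crossOnce r.1 r.2 = true
  red_disjoint : ∀ r ∈ S.red, r.1.1 ≠ r.2.1 ∧ r.1.1 ≠ r.2.2 ∧ r.1.2 ≠ r.2.1 ∧ r.1.2 ≠ r.2.2
  red_unique : ∀ r ∈ S.red, ∀ r₂ ∈ S.red,
    (r.1 = r₂.1 → r = r₂) ∧ (r.2 = r₂.2 → r = r₂) ∧ r.1 ≠ r₂.2

/-- A test for validity. -/
def check [DecidableEq V] [Fintype V] : Bool :=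
  decide (∀ u v, S.pos u = S.pos v → u = v) &&
  decide (S.edges.map fun d => s(d.1, d.2)).Nodup &&
  (S.edges.all fun d => decide (d.1 ≠ d.2) &&
    ((S.bend d).all fun M => hinged (M, S.pos d.1) (M, S.pos d.2)) &&
    decide (∀ w, w = d.1 ∨ w = d.2 ∨
      ((S.pieces d).all fun s => apart s (S.pos w, S.pos w)) = true)) &&
  decide (S.edges.Pairwise fun d d' => (S.bend d = none ∨ S.bend d ≠ S.bend d') ∧
    (S.meetOnlyAtEnds d d' = true ∨ (d, d') ∈ S.red ∨ (d', d) ∈ S.red)) &&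
  (S.red.all fun r => S.crossOnce r.1 r.2 &&
    decide (r.1.1 ≠ r.2.1 ∧ r.1.1 ≠ r.2.2 ∧ r.1.2 ≠ r.2.1 ∧ r.1.2 ≠ r.2.2) &&
    S.red.all fun r' =>
      decide ((r.1 = r'.1 → r = r') ∧ (r.2 = r'.2 → r = r') ∧ r.1 ≠ r'.2))

theorem valid_of_check [DecidableEq V] [Fintype V] (h : S.check = true) : S.Valid := by
  simp only [check, Bool.and_eq_true, decide_eq_true_eq, List.all_eq_true] at h
  obtain ⟨⟨⟨⟨h₁, h₂⟩, h₃⟩, h₄⟩, h₅⟩ := h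
  exact ⟨h₁, h₂, fun d hd => (h₃ d hd).1.1, fun d hd => (h₃ d hd).1.2,
    fun d hd w => by simpa using (h₃ d hd).2 w, h₄, fun r hr => (h₅ r hr).1.1,
    fun r hr => (h₅ r hr).1.2, fun r hr => (h₅ r hr).2⟩

instance [DecidableEq V] : DecidableRel S.graph.Adj :=
  fun u v => inferInstanceAs (Decidable (u ≠ v ∧ ((u, v) ∈ S.edges ∨ (v, u) ∈ S.edges)))

variable {S}

theorem graph_adj {u v : V} :
    S.graph.Adj u v ↔ u ≠ v ∧ ((u, v) ∈ S.edges ∨ (v, u) ∈ S.edges) := Iff.rfl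

theorem mem_edges_of_red {r : (V × V) × (V × V)} (h : r ∈ S.red) :
    r.1 ∈ S.edges ∧ r.2 ∈ S.edges := by
  simp only [edges, List.mem_append, List.mem_map]
  exact ⟨.inr (.inl ⟨r, h, rfl⟩), .inr (.inr ⟨r, h, rfl⟩)⟩

theorem exists_end {d : V × V} {s : (ℕ × ℕ) × (ℕ × ℕ)} (hs : s ∈ S.pieces d) {A : ℕ × ℕ}
    (hA : A = s.1 ∨ A = s.2) : (∃ u, A = S.pos u) ∨ S.bend d = some A := by
  unfold pieces at hs
  split at hs
  · rw [List.mem_singleton] at hs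
    subst hs
    rcases hA with rfl | rfl
    · exact .inl ⟨_, rfl⟩
    · exact .inl ⟨_, rfl⟩
  · rename_i M hM
    simp only [List.mem_cons, List.not_mem_nil, or_false] at hs
    rcases hs with rfl | rfl <;> rcases hA with rfl | rfl
    · exact .inl ⟨_, rfl⟩
    · exact .inr hM
    · exact .inr hM
    · exact .inl ⟨_, rfl⟩

/-- Ends of pieces are vertices or bends, and `hb` excludes a shared bend. -/
theorem exists_pos_of_meetOnlyAtEnds {d d' : V × V} (h : S.meetOnlyAtEnds d d' = true)
    (hb : S.bend d = none ∨ S.bend d ≠ S.bend d') {X : ℝ × ℝ} (hX : X ∈ S.carrier d)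
    (hX' : X ∈ S.carrier d') : ∃ u, gridPoint (S.pos u) = X := by
  obtain ⟨s, hs, hXs⟩ := hX
  obtain ⟨t, ht, hXt⟩ := hX'
  simp only [meetOnlyAtEnds, List.all_eq_true] at h
  obtain ⟨A, rfl, hA, hA'⟩ := eq_end_of_meetAtEnds (h s hs t ht) hXs hXt
  rcases exists_end hs hA with ⟨u, rfl⟩ | h₁
  · exact ⟨u, rfl⟩
  rcases exists_end ht hA' with ⟨u, rfl⟩ | h₂
  · exact ⟨u, rfl⟩
  rw [h₁, h₂] at hb
  simp at hb

theorem exists_of_crossOnce {d d' : V × V} (h : S.crossOnce d d' = true) :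
    ∃ X, X ∈ S.carrier d ∧ X ∈ S.carrier d' := by
  simp only [crossOnce, List.any_eq_true, Bool.and_eq_true] at h
  obtain ⟨s, hs, t, ht, h, -⟩ := h
  obtain ⟨X, hX⟩ := exists_of_properCross h
  exact ⟨X, ⟨s, hs, hX.1⟩, ⟨t, ht, hX.2⟩⟩

theorem eq_of_crossOnce {d d' : V × V} (h : S.crossOnce d d' = true) {X Y : ℝ × ℝ}
    (hX : X ∈ S.carrier d) (hX' : X ∈ S.carrier d') (hY : Y ∈ S.carrier d)
    (hY' : Y ∈ S.carrier d') : X = Y := by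
  simp only [crossOnce, List.any_eq_true, Bool.and_eq_true, List.all_eq_true, Bool.or_eq_true,
    decide_eq_true_eq] at h
  obtain ⟨s, -, t, -, h, hall⟩ := h
  have key : ∀ Z ∈ S.carrier d, Z ∈ S.carrier d' → Z ∈ seg s ∧ Z ∈ seg t := by
    rintro Z ⟨s', hs', hZ⟩ ⟨t', ht', hZ'⟩
    rcases hall s' hs' t' ht' with ⟨rfl, rfl⟩ | h'
    · exact ⟨hZ, hZ'⟩
    · exact (disjoint_of_apart h' hZ hZ').elim
  exact eq_of_properCross h (key X hX hX').1 (key X hX hX').2 (key Y hY hY').1 (key Y hY hY').2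

/-! ### From valid data to a 1-planar drawing -/

namespace Valid

theorem adj (hS : S.Valid) {d : V × V} (h : d ∈ S.edges) : S.graph.Adj d.1 d.2 :=
  ⟨hS.loopless d h, .inl h⟩

theorem mem_edgeSet_iff (hS : S.Valid) {e : Sym2 V} :
    e ∈ S.graph.edgeSet ↔ ∃ d ∈ S.edges, s(d.1, d.2) = e := by
  constructor
  · induction e with | _ u v
    rintro ⟨-, h | h⟩
    · exact ⟨_, h, rfl⟩
    · exact ⟨_, h, Sym2.eq_swap⟩
  · rintro ⟨d, h, rfl⟩
    exact hS.adj h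

theorem eq_of_sym2_eq (hS : S.Valid) {d d' : V × V} (h : d ∈ S.edges) (h' : d' ∈ S.edges)
    (hd : s(d.1, d.2) = s(d'.1, d'.2)) : d = d' :=
  List.inj_on_of_nodup_map hS.nodup h h' hd

/-- The two pieces of a bent edge are not collinear, so they meet only in the bend. -/
theorem isSimpleArc (hS : S.Valid) {d : V × V} (h : d ∈ S.edges) :
    IsSimpleArc (gridPoint (S.pos d.1)) (gridPoint (S.pos d.2)) (S.carrier d) := by
  have hsimple := hS.bend_simple d h
  have hne : ∀ {A B : ℕ × ℕ}, A ≠ B → gridPoint A ≠ gridPoint B :=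
    fun h h' => h (gridPoint_injective h')
  unfold carrier pieces
  split
  · simpa [seg] using isSimpleArc_segment (hne fun h' => hS.loopless d h (hS.pos_injective _ _ h'))
  · rename_i M hM
    rw [hM, Option.all_some] at hsimple
    obtain ⟨h₁, h₂⟩ := ne_of_hinged hsimple
    have := (isSimpleArc_segment (hne h₁.symm)).union (isSimpleArc_segment (hne h₂))
      fun X hX hX' => (eq_of_hinged hsimple ((seg_swap (_, _)).symm ▸ hX) hX').1
    convert this using 1
    ext X
    simp [seg]

theorem eq_end_of_mem_carrier (hS : S.Valid) {d : V × V} (h : d ∈ S.edges) {w : V}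
    (hw : gridPoint (S.pos w) ∈ S.carrier d) : w = d.1 ∨ w = d.2 := by
  rcases hS.avoids d h w with h | h | h
  · exact .inl h
  · exact .inr h
  · obtain ⟨s, hs, hX⟩ := hw
    rw [List.all_eq_true] at h
    -- The vertex is tested as a degenerate segment.
    exact (disjoint_of_apart (h s hs) hX (left_mem_segment ℝ _ _)).elim

/-- The drawing given by the data. -/
def drawing (hS : S.Valid) : Drawing S.graph where
  point v := gridPoint (S.pos v)
  arc e := {X | ∃ d ∈ S.edges, s(d.1, d.2) = e ∧ X ∈ S.carrier d}
  point_injective u v h := hS.pos_injective u v (gridPoint_injective h)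
  arc_simple u v h := by
    have key : ∀ d ∈ S.edges, {X | ∃ d' ∈ S.edges, s(d'.1, d'.2) = s(d.1, d.2) ∧
        X ∈ S.carrier d'} = S.carrier d := by
      intro d hd
      ext X
      constructor
      · rintro ⟨d', hd', hdd, hX⟩
        rwa [← hS.eq_of_sym2_eq hd' hd hdd]
      · exact fun hX => ⟨d, hd, rfl, hX⟩
    rcases h.2 with h | h
    · rw [key _ h]
      exact hS.isSimpleArc h
    · rw [Sym2.eq_swap, key _ h]
      exact (hS.isSimpleArc h).symm
  vertex_of_mem e _ w := by
    rintro ⟨d, hd, rfl, hX⟩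
    exact Sym2.mem_iff.2 (hS.eq_end_of_mem_carrier hd hX)

theorem red_of_mem_carrier (hS : S.Valid) {d d' : V × V} (hd : d ∈ S.edges) (hd' : d' ∈ S.edges)
    (h : d ≠ d') {X : ℝ × ℝ} (hX : X ∈ S.carrier d) (hX' : X ∈ S.carrier d')
    (hv : X ∉ Set.range hS.drawing.point) : (d, d') ∈ S.red ∨ (d', d) ∈ S.red := by
  -- The pairwise condition holds in list order only; symmetrizing it makes it available for any two
  -- distinct edges.
  let R (d d' : V × V) : Prop := ∀ X ∈ S.carrier d, X ∈ S.carrier d' →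
    X ∉ Set.range hS.drawing.point → (d, d') ∈ S.red ∨ (d', d) ∈ S.red
  have : Std.Symm R := ⟨fun d d' h X hX hX' hv => (h X hX' hX hv).symm⟩
  have hR : S.edges.Pairwise R :=
    hS.uncrossed.imp fun {d d'} h X hX hX' hv => h.2.resolve_left fun hm =>
      hv (exists_pos_of_meetOnlyAtEnds hm h.1 hX hX')
  exact hR.forall hd hd' h X hX hX' hv

theorem exists_red_of_crossAt (hS : S.Valid) {e f : Sym2 V} {X : ℝ × ℝ}
    (h : hS.drawing.CrossAt e f X) :
    ∃ d d', s(d.1, d.2) = e ∧ s(d'.1, d'.2) = f ∧ X ∈ S.carrier d ∧ X ∈ S.carrier d' ∧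
      ((d, d') ∈ S.red ∨ (d', d) ∈ S.red) := by
  obtain ⟨-, -, hne, ⟨d, hd, rfl, hX⟩, ⟨d', hd', rfl, hX'⟩, hv⟩ := h
  exact ⟨d, d', rfl, rfl, hX, hX',
    hS.red_of_mem_carrier hd hd' (by rintro rfl; exact hne rfl) hX hX' hv⟩

/-- Crossing edges form a listed red pair. By `red_unique` an edge lies in only one such pair, and
`crossOnce` leaves one common point. -/
theorem isOnePlanar (hS : S.Valid) : hS.drawing.IsOnePlanar := by
  intro e f f' X X' h h'
  obtain ⟨d, g, rfl, rfl, hX, hX', hr⟩ := hS.exists_red_of_crossAt h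
  obtain ⟨d₂, g', hd, rfl, hY, hY', hr'⟩ := hS.exists_red_of_crossAt h'
  have hd₁ : d ∈ S.edges := hr.elim (fun h => (mem_edges_of_red h).1)
    fun h => (mem_edges_of_red h).2
  have hd₂ : d₂ ∈ S.edges := hr'.elim (fun h => (mem_edges_of_red h).1)
    fun h => (mem_edges_of_red h).2
  obtain rfl := hS.eq_of_sym2_eq hd₂ hd₁ hd
  rcases hr with hr | hr <;> rcases hr' with hr' | hr'
  · have := (hS.red_unique _ hr _ hr').1 rfl
    obtain rfl : g = g' := by simpa using this
    exact ⟨rfl, eq_of_crossOnce (hS.crossed _ hr) hX hX' hY hY'⟩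
  · exact absurd rfl (hS.red_unique _ hr _ hr').2.2
  · exact absurd rfl (hS.red_unique _ hr' _ hr).2.2
  · have := (hS.red_unique _ hr _ hr').2.1 rfl
    obtain rfl : g = g' := by simpa using this
    exact ⟨rfl, eq_of_crossOnce (hS.crossed _ hr) hX' hX hY' hY⟩

/-- A vertex at the common point would be an end of both edges, but the edges of a red pair share no
end. -/
theorem crosses (hS : S.Valid) {d d' : V × V} (h : (d, d') ∈ S.red) :
    hS.drawing.Crosses s(d.1, d.2) s(d'.1, d'.2) := by
  obtain ⟨X, hX, hX'⟩ := exists_of_crossOnce (hS.crossed _ h)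
  obtain ⟨hd, hd'⟩ := mem_edges_of_red h
  have hdisj := hS.red_disjoint _ h
  refine ⟨X, hS.adj hd, hS.adj hd', ?_, ⟨d, hd, rfl, hX⟩, ⟨d', hd', rfl, hX'⟩, ?_⟩
  · intro he
    rcases Sym2.mk_eq_mk_iff.1 he with he | he
    · exact hdisj.1 (congrArg Prod.fst he)
    · exact hdisj.2.1 (congrArg Prod.fst he)
  · rintro ⟨w, rfl⟩
    have h₁ := hS.eq_end_of_mem_carrier hd hX
    have h₂ := hS.eq_end_of_mem_carrier hd' hX'
    rcases h₁ with rfl | rfl <;> rcases h₂ with h₂ | h₂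
    · exact hdisj.1 h₂
    · exact hdisj.2.1 h₂
    · exact hdisj.2.2.1 h₂
    · exact hdisj.2.2.2 h₂

theorem black (hS : S.Valid) {d : V × V} (h : d ∈ S.edges) (hr : ∀ r ∈ S.red, r.1 ≠ d ∧ r.2 ≠ d) :
    hS.drawing.Black s(d.1, d.2) := by
  refine ⟨hS.adj h, ?_⟩
  rintro f ⟨X, hX⟩
  obtain ⟨d₁, d', hd, -, -, -, hr'⟩ := hS.exists_red_of_crossAt hX
  have hd₁ : d₁ ∈ S.edges := hr'.elim (fun h => (mem_edges_of_red h).1)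
    fun h => (mem_edges_of_red h).2
  obtain rfl := hS.eq_of_sym2_eq hd₁ h hd
  exact hr'.elim (fun h => (hr _ h).1 rfl) fun h => (hr _ h).2 rfl

theorem ncard_edgeSet (hS : S.Valid) : S.graph.edgeSet.ncard = S.edges.length := by
  classical
  have : S.graph.edgeSet = ((S.edges.map fun d => s(d.1, d.2)).toFinset : Set (Sym2 V)) := by
    ext e
    simp [hS.mem_edgeSet_iff]
  rw [this, Set.ncard_coe_finset, List.toFinset_card_of_nodup hS.nodup, List.length_map]

end Valid

end Sketch

/-! ### Restricting drawings along embeddings -/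

namespace Drawing

variable {V W : Type} {G : SimpleGraph V} {H : SimpleGraph W}

theorem map_mem_edgeSet {ι : V → W} (h : ∀ u v, G.Adj u v → H.Adj (ι u) (ι v)) {e : Sym2 V}
    (he : e ∈ G.edgeSet) : e.map ι ∈ H.edgeSet := by
  induction e with | _ u v
  exact h u v he

/-- A drawing of `H` restricts to every graph that is mapped injectively into `H`. -/
def comap (D : Drawing H) {ι : V → W} (hι : Function.Injective ι)
    (h : ∀ u v, G.Adj u v → H.Adj (ι u) (ι v)) : Drawing G where
  point v := D.point (ι v)
  arc e := D.arc (e.map ι)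
  point_injective := D.point_injective.comp hι
  arc_simple u v huv := D.arc_simple _ _ (h u v huv)
  vertex_of_mem e he w hw := by
    obtain ⟨v, hv, hvw⟩ := Sym2.mem_map.1 (D.vertex_of_mem _ (map_mem_edgeSet h he) _ hw)
    rwa [← hι hvw]

variable {D : Drawing H} {ι : V → W} {hι : Function.Injective ι}
  {h : ∀ u v, G.Adj u v → H.Adj (ι u) (ι v)}

theorem crossAt_of_comap {e f : Sym2 V} {P : ℝ × ℝ} (hc : (D.comap hι h).CrossAt e f P) :
    D.CrossAt (e.map ι) (f.map ι) P := by
  obtain ⟨he, hf, hne, hPe, hPf, hP⟩ := hc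
  refine ⟨map_mem_edgeSet h he, map_mem_edgeSet h hf, (Sym2.map.injective hι).ne hne, hPe, hPf,
    ?_⟩
  rintro ⟨w, rfl⟩
  -- A vertex of `H` on the arc is an end of the image edge, hence comes from `G`; so forgetting
  -- vertices creates no new crossings.
  obtain ⟨v, -, rfl⟩ := Sym2.mem_map.1 (D.vertex_of_mem _ (map_mem_edgeSet h he) _ hPe)
  exact hP ⟨v, rfl⟩

theorem IsOnePlanar.comap (hD : D.IsOnePlanar) : (D.comap hι h).IsOnePlanar := by
  intro e f f' P P' hc hc'
  obtain ⟨h₁, h₂⟩ := hD _ _ _ _ _ (crossAt_of_comap hc) (crossAt_of_comap hc')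
  exact ⟨Sym2.map.injective hι h₁, h₂⟩

theorem Black.comap {u v : V} (huv : G.Adj u v) (hb : D.Black s(ι u, ι v)) :
    (D.comap hι h).Black s(u, v) :=
  ⟨huv, fun _ ⟨_, hP⟩ => hb.2 _ ⟨_, crossAt_of_comap hP⟩⟩

theorem Crosses.comap {e f : Sym2 V} (he : e ∈ G.edgeSet) (hf : f ∈ G.edgeSet)
    (hc : D.Crosses (e.map ι) (f.map ι)) : (D.comap hι h).Crosses e f := by
  obtain ⟨P, -, -, hne, hPe, hPf, hP⟩ := hc
  exact ⟨P, he, hf, fun hef => hne (hef ▸ rfl), hPe, hPf, fun ⟨v, hv⟩ => hP ⟨ι v, hv⟩⟩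

theorem Kite.comap (hG : ∀ u v, G.Adj u v ↔ H.Adj (ι u) (ι v)) {a b c d : V}
    (hk : D.Kite (ι a) (ι b) (ι c) (ι d)) :
    (D.comap hι fun u v => (hG u v).1).Kite a b c d := by
  obtain ⟨h₁, h₂, h₃, h₄, h₅⟩ := hk
  have hc := h₅
  obtain ⟨P, hac, hbd, -⟩ := hc
  exact ⟨h₁.comap ((hG _ _).2 h₁.1), h₂.comap ((hG _ _).2 h₂.1), h₃.comap ((hG _ _).2 h₃.1),
    h₄.comap ((hG _ _).2 h₄.1), Crosses.comap ((hG _ _).2 hac) ((hG _ _).2 hbd) h₅⟩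

end Drawing

/-! ### Induced subgraphs that contain all edges -/

/-- The map `ι` identifies `G` with the graph that arises from `H` by removing the isolated
vertices `r`. -/
structure IsModel {V W : Type} (r : List W) (H : SimpleGraph W) (G : SimpleGraph V)
    (ι : V → W) : Prop where
  injective : Function.Injective ι
  range : ∀ w, w ∉ r ↔ ∃ v, ι v = w
  adj : ∀ u v, G.Adj u v ↔ H.Adj (ι u) (ι v)
  support : ∀ u v, H.Adj u v → u ∉ r

namespace IsModel

variable {V W : Type} {r : List W} {H : SimpleGraph W} {G : SimpleGraph V} {ι : V → W}

theorem subtype (h : ∀ u v, H.Adj u v → u ∉ r) :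
    IsModel r H (H.comap (Subtype.val : {w // w ∉ r} → W)) Subtype.val :=
  ⟨Subtype.val_injective, fun w => by simp, fun _ _ => Iff.rfl, h⟩

theorem exists_of_adj (hM : IsModel r H G ι) {u v : W} (h : H.Adj u v) : ∃ a, ι a = u :=
  (hM.range u).1 (hM.support u v h)

theorem deg_eq (hM : IsModel r H G ι) (v : V) : deg G v = deg H (ι v) := by
  have : H.neighborSet (ι v) = ι '' G.neighborSet v := by
    ext w
    constructor
    · intro hw
      obtain ⟨u, rfl⟩ := hM.exists_of_adj (H.adj_symm hw)
      exact ⟨u, (hM.adj _ _).2 hw, rfl⟩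
    · rintro ⟨u, hu, rfl⟩
      exact (hM.adj _ _).1 hu
  rw [deg, deg, this, Set.ncard_image_of_injective _ hM.injective]

theorem ncard_edgeSet (hM : IsModel r H G ι) : G.edgeSet.ncard = H.edgeSet.ncard := by
  have : H.edgeSet = Sym2.map ι '' G.edgeSet := by
    ext e
    constructor
    · induction e with | _ u v
      intro he
      obtain ⟨a, rfl⟩ := hM.exists_of_adj he
      obtain ⟨b, rfl⟩ := hM.exists_of_adj (H.adj_symm he)
      exact ⟨s(a, b), (hM.adj _ _).2 he, rfl⟩
    · rintro ⟨e, he, rfl⟩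
      exact Drawing.map_mem_edgeSet (fun u v => (hM.adj u v).1) he
  rw [this, Set.ncard_image_of_injective _ (Sym2.map.injective hM.injective)]

theorem card_add_length (hM : IsModel r H G ι) [Fintype W] (hr : r.Nodup) :
    Nat.card V + r.length = Fintype.card W := by
  classical
  have h₁ : Set.range ι = (r.toFinset : Set W)ᶜ := by
    ext w
    simp [hM.range w]
  have h₂ : Nat.card V = (Set.range ι).ncard := by
    rw [← Set.image_univ, Set.ncard_image_of_injective _ hM.injective, Set.ncard_univ]
  rw [h₂, h₁, ← List.toFinset_card_of_nodup hr, ← Set.ncard_coe_finset r.toFinset,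
    ← Nat.card_eq_fintype_card, add_comm, Set.ncard_add_ncard_compl]

/-- The restriction of a drawing of `H` to `G`. -/
def drawing (hM : IsModel r H G ι) (D : Drawing H) : Drawing G :=
  D.comap hM.injective fun u v => (hM.adj u v).1

theorem isOnePlanar (hM : IsModel r H G ι) {D : Drawing H} (hD : D.IsOnePlanar) :
    (hM.drawing D).IsOnePlanar :=
  hD.comap

theorem kite (hM : IsModel r H G ι) {D : Drawing H} {a b c d : V}
    (hk : D.Kite (ι a) (ι b) (ι c) (ι d)) : (hM.drawing D).Kite a b c d :=
  hk.comap hM.adj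

end IsModel

/-- Discarding isolated vertices affects only the vertex count `n`, which becomes the size of `W`
minus the length of `r`. The numerical hypotheses are `n ≥ 3` and the count of `4n - 8` edges,
written without subtraction. -/
theorem isOptimal_of_isModel {W : Type} [Fintype W] {G : FinGraph} {S : Sketch W}
    (hS : S.Valid) {r : List W} (hr : r.Nodup) {ι : G.V → W}
    (hM : IsModel r S.graph G.graph ι) (hn : r.length + 3 ≤ Fintype.card W)
    (hm : S.edges.length + 8 + 4 * r.length = 4 * Fintype.card W) : IsOptimal G := by
  have hc := hM.card_add_length hr
  refine ⟨by omega, ?_, hM.drawing hS.drawing, hM.isOnePlanar hS.isOnePlanar⟩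
  rw [hM.ncard_edgeSet, hS.ncard_edgeSet]
  omega

/-- Two graphs that are embedded onto the same vertices with the same edges are isomorphic. -/
theorem nonempty_iso_of_range_eq {A B W : Type} {G : SimpleGraph A} {H : SimpleGraph B}
    {ι : A → W} {κ : B → W} (hι : Function.Injective ι) (hκ : Function.Injective κ)
    (hr : Set.range ι = Set.range κ)
    (hadj : ∀ a a' b b', ι a = κ b → ι a' = κ b' → (H.Adj b b' ↔ G.Adj a a')) :
    Nonempty (G ≃g H) := by
  let e : A ≃ B := (Equiv.ofInjective ι hι).trans
    ((Equiv.setCongr hr).trans (Equiv.ofInjective κ hκ).symm)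
  have he : ∀ a, ι a = κ (e a) := by
    intro a
    simp [e, Equiv.apply_ofInjective_symm]
  exact ⟨⟨e, fun {a b} => hadj _ _ _ _ (he a) (he b)⟩⟩

/-! ### Reduction steps between sketches -/

theorem deg_eq_card_filter {V : Type} [Fintype V] (G : SimpleGraph V) [DecidableRel G.Adj]
    (v : V) : deg G v = (Finset.univ.filter fun u => G.Adj v u).card := by
  have : G.neighborSet v = (Finset.univ.filter fun u => G.Adj v u : Finset V) := by
    ext u
    simp
  rw [deg, this, Set.ncard_coe_finset]

namespace Sketch

variable {W : Type} {S : Sketch W}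

theorem Valid.drawing_black (hS : S.Valid) {u v : W} (h : (u, v) ∈ S.black ∨ (v, u) ∈ S.black) :
    hS.drawing.Black s(u, v) := by
  have hn := hS.nodup.of_map
  have key : ∀ d ∈ S.black, hS.drawing.Black s(d.1, d.2) := by
    intro d hd
    refine hS.black (List.mem_append_left _ hd) fun r hr => ?_
    -- As the full edge list has no repetitions, a listed black edge occurs in no red pair.
    have hdisj := (List.nodup_append.1 hn).2.2 d hd
    exact ⟨(hdisj _ (List.mem_append_left _ (List.mem_map_of_mem hr))).symm,
      (hdisj _ (List.mem_append_right _ (List.mem_map_of_mem hr))).symm⟩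
  rcases h with h | h
  · exact key _ h
  · rw [Sym2.eq_swap]
    exact key _ h

theorem crosses_symm {G : SimpleGraph W} {D : Drawing G} {e f : Sym2 W} (h : D.Crosses e f) :
    D.Crosses f e := by
  obtain ⟨P, h₁, h₂, h₃, h₄, h₅, h₆⟩ := h
  exact ⟨P, h₂, h₁, h₃.symm, h₅, h₄, h₆⟩

variable [DecidableEq W] (S)

/-- A test for kites. -/
def isKite (a b c d : W) : Bool :=
  ([(a, b), (b, c), (c, d), (d, a)].all fun e => decide (e ∈ S.black ∨ e.swap ∈ S.black)) &&
    S.red.any fun r =>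
      (decide (s(r.1.1, r.1.2) = s(a, c)) && decide (s(r.2.1, r.2.2) = s(b, d))) ||
      (decide (s(r.1.1, r.1.2) = s(b, d)) && decide (s(r.2.1, r.2.2) = s(a, c)))

variable {S}

theorem Valid.kite (hS : S.Valid) {a b c d : W} (h : S.isKite a b c d = true) :
    hS.drawing.Kite a b c d := by
  simp only [isKite, Bool.and_eq_true, List.all_eq_true, decide_eq_true_eq, List.any_eq_true,
    Bool.or_eq_true] at h
  obtain ⟨hb, r, hr, hc⟩ := h
  refine ⟨hS.drawing_black (hb (a, b) (by simp)), hS.drawing_black (hb (b, c) (by simp)),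
    hS.drawing_black (hb (c, d) (by simp)), hS.drawing_black (hb (d, a) (by simp)), ?_⟩
  have := hS.crosses hr
  rcases hc with ⟨h₁, h₂⟩ | ⟨h₁, h₂⟩
  · rwa [← h₁, ← h₂]
  · rw [← h₁, ← h₂]
    exact crosses_symm this

variable [Fintype W] (S)

/-- The degree of a vertex. -/
def degree (v : W) : ℕ := (Finset.univ.filter fun u => S.graph.Adj v u).card

theorem deg_graph (v : W) : deg S.graph v = S.degree v :=
  deg_eq_card_filter _ v

/-- `SR(x ↦ x₄)` can be applied to the drawing `S` and leads to the graph of `S'`. -/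
def SRApplies (S' : Sketch W) (x x₁ x₂ x₃ x₄ x₅ x₆ : W) : Prop :=
  [x, x₁, x₂, x₃, x₄, x₅, x₆].Nodup ∧ S.degree x = 6 ∧
    (S.isKite x x₁ x₂ x₃ = true ∧ S.isKite x x₃ x₄ x₅ = true ∧ S.isKite x x₅ x₆ x₁ = true) ∧
    (S.degree x₃ ≠ 6 ∧ S.degree x₅ ≠ 6 ∧ ¬ S.graph.Adj x₂ x₄ ∧ ¬ S.graph.Adj x₆ x₄ ∧
      ¬ S.graph.Adj x₁ x₄) ∧
    ∀ u v, u ≠ x → v ≠ x → (S'.graph.Adj u v ↔ (S.graph.Adj u v ∧ s(u, v) ≠ s(x₃, x₅)) ∨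
      (s(u, v) = s(x₁, x₄) ∨ s(u, v) = s(x₂, x₄) ∨ s(u, v) = s(x₆, x₄)) ∧ u ≠ v)

set_option synthInstance.maxSize 1000 in
instance (S' : Sketch W) (x x₁ x₂ x₃ x₄ x₅ x₆ : W) :
    Decidable (S.SRApplies S' x x₁ x₂ x₃ x₄ x₅ x₆) := by
  unfold SRApplies; infer_instance

/-- `CR(x₁, x₂, x₃, x₄)` can be applied to the drawing `S` and leads to the graph of `S'`. -/
def CRApplies (S' : Sketch W) (x₁ x₂ x₃ x₄ v₁ v₂ v₃ v₄ : W) : Prop :=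
  [x₁, x₂, x₃, x₄, v₁, v₂, v₃, v₄].Nodup ∧
    (S.degree x₁ = 6 ∧ S.degree x₂ = 6 ∧ S.degree x₃ = 6 ∧ S.degree x₄ = 6) ∧
    (S.isKite x₁ x₂ x₃ x₄ = true ∧ S.isKite x₁ x₂ v₂ v₁ = true ∧ S.isKite x₂ x₃ v₃ v₂ = true ∧
      S.isKite x₃ x₄ v₄ v₃ = true ∧ S.isKite x₄ x₁ v₁ v₄ = true) ∧
    (S.degree v₁ ≠ 6 ∧ S.degree v₂ ≠ 6 ∧ S.degree v₃ ≠ 6 ∧ S.degree v₄ ≠ 6 ∧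
      ¬ S.graph.Adj v₁ v₃ ∧ ¬ S.graph.Adj v₂ v₄) ∧
    ∀ u v, u ∉ [x₁, x₂, x₃, x₄] → v ∉ [x₁, x₂, x₃, x₄] → (S'.graph.Adj u v ↔
      S.graph.Adj u v ∨ (s(u, v) = s(v₁, v₃) ∨ s(u, v) = s(v₂, v₄)) ∧ u ≠ v)

set_option synthInstance.maxSize 1000 in
instance (S' : Sketch W) (x₁ x₂ x₃ x₄ v₁ v₂ v₃ v₄ : W) :
    Decidable (S.CRApplies S' x₁ x₂ x₃ x₄ v₁ v₂ v₃ v₄) := by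
  unfold CRApplies; infer_instance

end Sketch

theorem sym2_mk_eq_iff {V W : Type} {ι : V → W} (hι : Function.Injective ι) {a b c d : V} :
    s(ι a, ι b) = s(ι c, ι d) ↔ s(a, b) = s(c, d) := by
  simp [hι.eq_iff]

section Steps

variable {W : Type} [DecidableEq W] [Fintype W] {S S' : Sketch W} {G G' : FinGraph} {r : List W}
  {ι : G.V → W} {ι' : G'.V → W}

theorem srStep_of_applies (hS : S.Valid) (hG : IsOptimal G) (hG' : IsOptimal G')
    (hM : IsModel r S.graph G.graph ι) {x x₁ x₂ x₃ x₄ x₅ x₆ : W}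
    (hM' : IsModel (x :: r) S'.graph G'.graph ι')
    (h : S.SRApplies S' x x₁ x₂ x₃ x₄ x₅ x₆) : SRStep G G' := by
  obtain ⟨hd, hx, ⟨k₂, k₄, k₆⟩, ⟨u₁, u₂, u₃, u₄, u₅⟩, hadj⟩ := h
  have k₂ := hS.kite k₂
  have k₄ := hS.kite k₄
  have k₆ := hS.kite k₆
  -- Every vertex named by the rule is an end of a kite edge, hence not isolated, hence a vertex of
  -- `G`.
  obtain ⟨x, rfl⟩ := hM.exists_of_adj k₂.1.1
  obtain ⟨x₁, rfl⟩ := hM.exists_of_adj k₂.2.1.1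
  obtain ⟨x₂, rfl⟩ := hM.exists_of_adj k₂.2.2.1.1
  obtain ⟨x₃, rfl⟩ := hM.exists_of_adj k₄.2.1.1
  obtain ⟨x₄, rfl⟩ := hM.exists_of_adj k₄.2.2.1.1
  obtain ⟨x₅, rfl⟩ := hM.exists_of_adj k₆.2.1.1
  obtain ⟨x₆, rfl⟩ := hM.exists_of_adj k₆.2.2.1.1
  rw [← S.deg_graph, ← hM.deg_eq] at hx u₁ u₂
  rw [← hM.adj] at u₃ u₄ u₅
  refine ⟨hG, hG', hM.drawing hS.drawing, hM.isOnePlanar hS.isOnePlanar, x, x₁, x₂, x₃, x₄, x₅,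
    x₆, ⟨?_, hx, hM.kite k₂, hM.kite k₄, hM.kite k₆⟩, ⟨u₁, u₂, u₃, u₄, u₅⟩, ?_⟩
  · exact List.Nodup.of_map ι (by simpa using hd)
  · refine nonempty_iso_of_range_eq (ι := fun v => ι v.1) (κ := ι')
      (hM.injective.comp Subtype.val_injective) hM'.injective ?_ ?_
    · ext w
      simp only [Set.mem_range, ← hM'.range w, List.mem_cons, not_or, hM.range w]
      constructor
      · rintro ⟨⟨v, hv⟩, rfl⟩
        exact ⟨hM.injective.ne hv, v, rfl⟩
      · rintro ⟨hv, v, rfl⟩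
        exact ⟨⟨v, fun h => hv (h ▸ rfl)⟩, rfl⟩
    · rintro ⟨a, ha⟩ ⟨a', ha'⟩ b b' hab hab'
      rw [hM'.adj, ← hab, ← hab', hadj _ _ (hM.injective.ne ha) (hM.injective.ne ha')]
      simp only [← hM.adj, sym2_mk_eq_iff hM.injective, hM.injective.ne_iff, ne_eq]
      simp [srResult]

theorem crStep_of_applies (hS : S.Valid) (hG : IsOptimal G) (hG' : IsOptimal G')
    (hM : IsModel r S.graph G.graph ι) {x₁ x₂ x₃ x₄ v₁ v₂ v₃ v₄ : W}
    (hM' : IsModel (x₁ :: x₂ :: x₃ :: x₄ :: r) S'.graph G'.graph ι')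
    (h : S.CRApplies S' x₁ x₂ x₃ x₄ v₁ v₂ v₃ v₄) : CRStep G G' := by
  obtain ⟨hd, ⟨d₁, d₂, d₃, d₄⟩, ⟨k, k₁, k₂, k₃, k₄⟩, ⟨u₁, u₂, u₃, u₄, u₅, u₆⟩, hadj⟩ := h
  have k := hS.kite k
  have k₁ := hS.kite k₁
  have k₂ := hS.kite k₂
  have k₃ := hS.kite k₃
  have k₄ := hS.kite k₄
  obtain ⟨x₁, rfl⟩ := hM.exists_of_adj k.1.1
  obtain ⟨x₂, rfl⟩ := hM.exists_of_adj k.2.1.1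
  obtain ⟨x₃, rfl⟩ := hM.exists_of_adj k.2.2.1.1
  obtain ⟨x₄, rfl⟩ := hM.exists_of_adj k.2.2.2.1.1
  obtain ⟨v₁, rfl⟩ := hM.exists_of_adj k₁.2.2.2.1.1
  obtain ⟨v₂, rfl⟩ := hM.exists_of_adj k₂.2.2.2.1.1
  obtain ⟨v₃, rfl⟩ := hM.exists_of_adj k₃.2.2.2.1.1
  obtain ⟨v₄, rfl⟩ := hM.exists_of_adj k₄.2.2.2.1.1
  rw [← S.deg_graph, ← hM.deg_eq] at d₁ d₂ d₃ d₄ u₁ u₂ u₃ u₄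
  rw [← hM.adj] at u₅ u₆
  refine ⟨hG, hG', hM.drawing hS.drawing, hM.isOnePlanar hS.isOnePlanar, x₁, x₂, x₃, x₄, v₁, v₂,
    v₃, v₄, ⟨?_, d₁, d₂, d₃, d₄, hM.kite k, hM.kite k₁, hM.kite k₂, hM.kite k₃, hM.kite k₄⟩,
    ⟨u₁, u₂, u₃, u₄, u₅, u₆⟩, ?_⟩
  · exact List.Nodup.of_map ι (by simpa using hd)
  · have hne : ∀ v, (v ≠ x₁ ∧ v ≠ x₂ ∧ v ≠ x₃ ∧ v ≠ x₄) ↔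
        ι v ∉ [ι x₁, ι x₂, ι x₃, ι x₄] := by
      intro v
      simp [hM.injective.eq_iff]
    refine nonempty_iso_of_range_eq (ι := fun v => ι v.1) (κ := ι')
      (hM.injective.comp Subtype.val_injective) hM'.injective ?_ ?_
    · ext w
      simp only [Set.mem_range, ← hM'.range w]
      change _ ↔ w ∉ [ι x₁, ι x₂, ι x₃, ι x₄] ++ r
      rw [List.mem_append, not_or, hM.range w]
      constructor
      · rintro ⟨⟨v, hv⟩, rfl⟩
        exact ⟨(hne v).1 hv, v, rfl⟩
      · rintro ⟨hv, v, rfl⟩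
        exact ⟨⟨v, (hne v).2 hv⟩, rfl⟩
    · rintro ⟨a, ha⟩ ⟨a', ha'⟩ b b' hab hab'
      rw [hM'.adj, ← hab, ← hab', hadj _ _ ((hne a).1 ha) ((hne a').1 ha')]
      simp only [← hM.adj, sym2_mk_eq_iff hM.injective, hM.injective.ne_iff, ne_eq]
      simp [crResult]

end Steps

/-! ### Decidable adjacency in extended wheels -/

instance (k : ℕ) : DecidableRel (wheelRel k)
  | .inl _, .inr _ => .isTrue trivial
  | .inr i, .inr j => inferInstanceAs
      (Decidable (j.val = (i.val + 1) % (2 * k) ∨ j.val = (i.val + 2) % (2 * k)))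
  | .inl _, .inl _ => .isFalse id
  | .inr _, .inl _ => .isFalse id

instance (k : ℕ) : DecidableRel (extendedWheel k).Adj :=
  fun m n => inferInstanceAs (Decidable (m ≠ n ∧ (wheelRel k m n ∨ wheelRel k n m)))

/-! ### Drawings of `G₁₇` and the graphs obtained from it -/

section Data

open V17

/-- A grid point for each vertex of `G₁₇`. -/
def gridPos : V17 → ℕ × ℕ
  | .a => (12, 30) | .b => (26, 38) | .c => (11, 34) | .d => (10, 31) | .g => (10, 24)
  | .h => (7, 29) | .i => (3, 30) | .p => (33, 54) | .q => (0, 20) | .r => (0, 60)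
  | .s => (40, 60) | .t => (3, 52) | .u => (13, 23) | .v => (27, 29) | .w => (40, 20)
  | .y => (35, 21) | .z => (12, 22)

/-- The bends of the red edges in the outer face `r s w q`, and of the red edge `b q` if it is
directed from `b` to `q`; the face `b g q w` is not convex. -/
def gridBend : V17 × V17 → Option (ℕ × ℕ)
  | (.s, .q) => some (60, 0)
  | (.r, .w) => some (60, 100)
  | (.b, .q) => some (26, 24)
  | _ => none

/-- The drawing in which each of the consistently oriented faces `F` carries a kite. -/
def sketch (F : List (V17 × V17 × V17 × V17)) : Sketch V17 where
  pos := gridPos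
  bend := gridBend
  -- Consistent orientation lists every black edge once in each direction; comparing constructor
  -- indices keeps one of the two.
  black := (F.flatMap fun (k, l, m, n) => [(k, l), (l, m), (m, n), (n, k)]).filter
    fun e => e.1.ctorIdx < e.2.ctorIdx
  red := F.map fun (k, l, m, n) => ((k, m), (l, n))

/-- The faces that are common to all drawings. -/
def commonFaces : List (V17 × V17 × V17 × V17) :=
  [(r, s, w, q), (p, s, r, t), (p, b, w, s), (i, t, r, q)]

/-- The remaining faces of the skeleton of `G₁₇`. -/
def skeleton17 : List (V17 × V17 × V17 × V17) :=
  [(y, z, q, w), (p, t, i, c), (i, q, g, h), (z, u, g, q), (g, a, d, h), (d, c, i, h),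
   (p, c, d, a), (p, a, g, b), (u, v, b, g), (z, y, v, u), (v, y, w, b)] ++ commonFaces

/-- The skeleton after merging `h` into `q`. -/
def skeleton16 : List (V17 × V17 × V17 × V17) :=
  [(y, z, q, w), (p, t, i, c), (d, c, i, q), (p, c, d, a), (d, q, g, a), (z, u, g, q),
   (p, a, g, b), (u, v, b, g), (z, y, v, u), (v, y, w, b)] ++ commonFaces

/-- The skeleton after merging `h` into `q` and removing the cube `u v y z`. -/
def skeletonXW10 : List (V17 × V17 × V17 × V17) :=
  [(b, g, q, w), (p, t, i, c), (d, c, i, q), (p, c, d, a), (d, q, g, a), (p, a, g, b)] ++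
    commonFaces

/-- The skeleton after merging `h` into `q` and `a` into `b`. -/
def skeleton15 : List (V17 × V17 × V17 × V17) :=
  [(y, z, q, w), (p, t, i, c), (d, c, i, q), (b, p, c, d), (q, g, b, d), (z, u, g, q),
   (u, v, b, g), (z, y, v, u), (v, y, w, b)] ++ commonFaces

/-- The skeleton after merging also `d` into `g`. -/
def skeleton14 : List (V17 × V17 × V17 × V17) :=
  [(y, z, q, w), (p, t, i, c), (c, i, q, g), (z, u, g, q), (c, g, b, p), (u, v, b, g),
   (z, y, v, u), (v, y, w, b)] ++ commonFaces

/-- The skeleton after merging also `c` into `b`. -/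
def skeleton13 : List (V17 × V17 × V17 × V17) :=
  [(y, z, q, w), (b, p, t, i), (q, g, b, i), (z, u, g, q), (u, v, b, g), (z, y, v, u),
   (v, y, w, b)] ++ commonFaces

/-- The skeleton after merging also `g` into `i`. -/
def skeleton12 : List (V17 × V17 × V17 × V17) :=
  [(y, z, q, w), (b, p, t, i), (i, q, z, u), (z, y, v, u), (v, b, i, u), (v, y, w, b)] ++
    commonFaces

/-- The skeleton after removing also the cube `u v y z`. -/
def skeletonXW6 : List (V17 × V17 × V17 × V17) :=
  [(q, w, b, i), (b, p, t, i)] ++ commonFaces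

/-! ### Validity of the eight drawings -/

theorem valid_skeleton17 : (sketch skeleton17).Valid :=
  Sketch.valid_of_check _ (by decide +kernel)

theorem valid_skeleton16 : (sketch skeleton16).Valid :=
  Sketch.valid_of_check _ (by decide +kernel)

theorem valid_skeletonXW10 : (sketch skeletonXW10).Valid :=
  Sketch.valid_of_check _ (by decide +kernel)

theorem valid_skeleton15 : (sketch skeleton15).Valid :=
  Sketch.valid_of_check _ (by decide +kernel)

theorem valid_skeleton14 : (sketch skeleton14).Valid :=
  Sketch.valid_of_check _ (by decide +kernel)

theorem valid_skeleton13 : (sketch skeleton13).Valid :=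
  Sketch.valid_of_check _ (by decide +kernel)

theorem valid_skeleton12 : (sketch skeleton12).Valid :=
  Sketch.valid_of_check _ (by decide +kernel)

theorem valid_skeletonXW6 : (sketch skeletonXW6).Valid :=
  Sketch.valid_of_check _ (by decide +kernel)

/-- The graph drawn in `sketch F` without the vertices `r`. -/
abbrev sketchGraph (F : List (V17 × V17 × V17 × V17)) (r : List V17) : FinGraph :=
  ⟨{n : V17 // n ∉ r}, inferInstance, (sketch F).graph.comap Subtype.val⟩

/-! ### The graphs as drawings without their isolated vertices -/

theorem model_skeleton16 : IsModel [h] (sketch skeleton16).graph (sketchGraph skeleton16 [h]).graph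
    Subtype.val :=
  .subtype (by decide +kernel)

theorem model_skeleton15 : IsModel [a, h] (sketch skeleton15).graph
    (sketchGraph skeleton15 [a, h]).graph Subtype.val :=
  .subtype (by decide +kernel)

theorem model_skeleton14 : IsModel [d, a, h] (sketch skeleton14).graph
    (sketchGraph skeleton14 [d, a, h]).graph Subtype.val :=
  .subtype (by decide +kernel)

theorem model_skeleton13 : IsModel [c, d, a, h] (sketch skeleton13).graph
    (sketchGraph skeleton13 [c, d, a, h]).graph Subtype.val :=
  .subtype (by decide +kernel)

theorem model_skeleton12 : IsModel [g, c, d, a, h] (sketch skeleton12).graph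
    (sketchGraph skeleton12 [g, c, d, a, h]).graph Subtype.val :=
  .subtype (by decide +kernel)

theorem model17 : IsModel [] (sketch skeleton17).graph graph17 id where
  injective := Function.injective_id
  range _ := by simp
  adj := by
    have : ∀ m n, (m ≠ n ∧ ((∃ F ∈ faces17, m ∈ F ∧ n ∈ F) ∨ ∃ F ∈ faces17, n ∈ F ∧ m ∈ F)) ↔
        (sketch skeleton17).graph.Adj m n := by decide +kernel
    exact this
  support := by simp

/-- The vertices of `XW₁₀` in the drawing. -/
def labelXW10 : Bool ⊕ Fin (2 * 5) → V17
  | .inl x => if x then p else q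
  -- This is the cyclic order of the neighbours around the pole `p`.
  | .inr j => ![r, s, w, b, g, a, d, c, i, t] j

/-- The vertices of `XW₆` in the drawing. -/
def labelXW6 : Bool ⊕ Fin (2 * 3) → V17
  | .inl x => if x then p else q
  | .inr j => ![r, s, w, b, i, t] j

theorem modelXW10 : IsModel [u, v, y, z, h] (sketch skeletonXW10).graph (extendedWheel 5)
    labelXW10 where
  injective := by
    have : ∀ m n, labelXW10 m = labelXW10 n → m = n := by decide +kernel
    exact this
  range := by decide +kernel
  adj := by decide +kernel
  support := by decide +kernel

theorem modelXW6 : IsModel [u, v, y, z, g, c, d, a, h] (sketch skeletonXW6).graph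
    (extendedWheel 3) labelXW6 where
  injective := by
    have : ∀ m n, labelXW6 m = labelXW6 n → m = n := by decide +kernel
    exact this
  range := by decide +kernel
  adj := by decide +kernel
  support := by decide +kernel

/-! ### Optimality of the graphs -/

theorem isOptimal_G17 : IsOptimal G17 :=
  isOptimal_of_isModel (G := G17) valid_skeleton17 (by decide) model17 (by decide) (by decide)

theorem isOptimal_XW10 : IsOptimal (XW 5) :=
  isOptimal_of_isModel (G := XW 5) valid_skeletonXW10 (by decide) modelXW10 (by decide)
    (by decide)

theorem isOptimal_XW6 : IsOptimal (XW 3) :=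
  isOptimal_of_isModel (G := XW 3) valid_skeletonXW6 (by decide) modelXW6 (by decide)
    (by decide)

theorem isOptimal_skeleton16 : IsOptimal (sketchGraph skeleton16 [h]) :=
  isOptimal_of_isModel valid_skeleton16 (by decide) model_skeleton16 (by decide) (by decide)

theorem isOptimal_skeleton15 : IsOptimal (sketchGraph skeleton15 [a, h]) :=
  isOptimal_of_isModel valid_skeleton15 (by decide) model_skeleton15 (by decide) (by decide)

theorem isOptimal_skeleton14 : IsOptimal (sketchGraph skeleton14 [d, a, h]) :=
  isOptimal_of_isModel valid_skeleton14 (by decide) model_skeleton14 (by decide) (by decide)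

theorem isOptimal_skeleton13 : IsOptimal (sketchGraph skeleton13 [c, d, a, h]) :=
  isOptimal_of_isModel valid_skeleton13 (by decide) model_skeleton13 (by decide) (by decide)

theorem isOptimal_skeleton12 : IsOptimal (sketchGraph skeleton12 [g, c, d, a, h]) :=
  isOptimal_of_isModel valid_skeleton12 (by decide) model_skeleton12 (by decide) (by decide)

/-! ### The individual reduction steps -/

theorem step_merge_h : Step G17 (sketchGraph skeleton16 [h]) :=
  -- The merged vertex `x` is found by unification, as the head of the list of deleted vertices of
  -- the target model.
  .inl (srStep_of_applies (G := G17) (x₁ := d) (x₂ := c) (x₃ := i) (x₄ := q) (x₅ := g) (x₆ := a)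
    valid_skeleton17 isOptimal_G17 isOptimal_skeleton16
    model17 model_skeleton16 (by decide +kernel))

theorem step_remove_cube_XW10 : Step (sketchGraph skeleton16 [h]) (XW 5) :=
  -- The inner cycle `u, v, y, z` is the start of the list in `modelXW10`, so the order of that list
  -- matters.
  .inr (crStep_of_applies (G' := XW 5) (v₁ := g) (v₂ := b) (v₃ := w) (v₄ := q)
    valid_skeleton16 isOptimal_skeleton16 isOptimal_XW10
    model_skeleton16 modelXW10 (by decide +kernel))

theorem step_merge_a : Step (sketchGraph skeleton16 [h]) (sketchGraph skeleton15 [a, h]) :=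
  .inl (srStep_of_applies (x₁ := d) (x₂ := c) (x₃ := p) (x₄ := b) (x₅ := g) (x₆ := q)
    valid_skeleton16 isOptimal_skeleton16 isOptimal_skeleton15
    model_skeleton16 model_skeleton15 (by decide +kernel))

theorem step_merge_d : Step (sketchGraph skeleton15 [a, h]) (sketchGraph skeleton14 [d, a, h]) :=
  .inl (srStep_of_applies (x₁ := c) (x₂ := i) (x₃ := q) (x₄ := g) (x₅ := b) (x₆ := p)
    valid_skeleton15 isOptimal_skeleton15 isOptimal_skeleton14
    model_skeleton15 model_skeleton14 (by decide +kernel))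

theorem step_merge_c :
    Step (sketchGraph skeleton14 [d, a, h]) (sketchGraph skeleton13 [c, d, a, h]) :=
  .inl (srStep_of_applies (x₁ := i) (x₂ := t) (x₃ := p) (x₄ := b) (x₅ := g) (x₆ := q)
    valid_skeleton14 isOptimal_skeleton14 isOptimal_skeleton13
    model_skeleton14 model_skeleton13 (by decide +kernel))

theorem step_merge_g :
    Step (sketchGraph skeleton13 [c, d, a, h]) (sketchGraph skeleton12 [g, c, d, a, h]) :=
  .inl (srStep_of_applies (x₁ := u) (x₂ := z) (x₃ := q) (x₄ := i) (x₅ := b) (x₆ := v)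
    valid_skeleton13 isOptimal_skeleton13 isOptimal_skeleton12
    model_skeleton13 model_skeleton12 (by decide +kernel))

theorem step_remove_cube_XW6 : Step (sketchGraph skeleton12 [g, c, d, a, h]) (XW 3) :=
  .inr (crStep_of_applies (G' := XW 3) (v₁ := i) (v₂ := b) (v₃ := w) (v₄ := q)
    valid_skeleton12 isOptimal_skeleton12 isOptimal_XW6
    model_skeleton12 modelXW6 (by decide +kernel))

end Data

theorem reduces_G17_XW10 : Reduces G17 (XW 5) :=
  ⟨XW 5, .head step_merge_h (.single step_remove_cube_XW10), ⟨.refl⟩⟩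

theorem reduces_G17_XW6 : Reduces G17 (XW 3) :=
  ⟨XW 3, .head step_merge_h <| .head step_merge_a <| .head step_merge_d <| .head step_merge_c <|
    .head step_merge_g (.single step_remove_cube_XW6), ⟨.refl⟩⟩

/-! ### Irreducibility and failure of confluence -/

theorem isIrreducible_XW6 : IsIrreducible (XW 3) := by
  have hdeg : ∀ v, deg (extendedWheel 3) v = 6 := by
    intro v
    rw [deg_eq_card_filter]
    revert v
    decide +kernel
  rintro H (⟨-, -, D, -, x, x₁, x₂, x₃, x₄, x₅, x₆, -, h, -⟩ |
    ⟨-, -, D, -, x₁, x₂, x₃, x₄, v₁, v₂, v₃, v₄, -, h, -⟩)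
  · exact h.1 (hdeg _)
  · exact h.1 (hdeg _)

theorem isIrreducible_XW10 : IsIrreducible (XW 5) := by
  have hdeg : ∀ v, deg (extendedWheel 5) v ≠ 6 → ∃ x, v = .inl x := by
    intro v
    rw [deg_eq_card_filter]
    revert v
    decide +kernel
  rintro H (⟨-, -, D, -, x, x₁, x₂, x₃, x₄, x₅, x₆, hm, h, -⟩ |
    ⟨-, -, D, -, x₁, x₂, x₃, x₄, v₁, v₂, v₃, v₄, hm, h, -⟩)
  · obtain ⟨s, rfl⟩ := hdeg _ h.1
    obtain ⟨t, rfl⟩ := hdeg _ h.2.1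
    -- The red edge `x₃x₅` of this kite would join two poles.
    obtain ⟨P, -, hadj, -⟩ := hm.kite₄.2.2.2.2
    exact hadj.2.elim id id
  · obtain ⟨s, rfl⟩ := hdeg _ h.1
    obtain ⟨t, rfl⟩ := hdeg _ h.2.1
    -- Here the black edge `v₂v₁` would join two poles.
    have hadj := hm.kite₁₂.2.2.1.1
    exact hadj.2.elim id id

/-- Only the empty chain of steps starts at an irreducible graph. -/
theorem IsIrreducible.nonempty_iso {G H : FinGraph} (hG : IsIrreducible G) (h : Reduces G H) :
    Nonempty (G.graph ≃g H.graph) := by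
  obtain ⟨K, hK, hiso⟩ := h
  rcases hK.cases_head with rfl | ⟨L, hL, -⟩
  · exact hiso
  · exact (hG L hL).elim

theorem not_isConfluent : ¬ IsConfluent := by
  intro h
  obtain ⟨Z, h₁, h₂⟩ := h G17 _ _ isOptimal_G17 reduces_G17_XW10 reduces_G17_XW6
  obtain ⟨e₁⟩ := isIrreducible_XW10.nonempty_iso h₁
  obtain ⟨e₂⟩ := isIrreducible_XW6.nonempty_iso h₂
  -- The vertex counts are 12 and 8.
  have := Nat.card_congr (e₁.toEquiv.trans e₂.toEquiv.symm)
  simp at this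

end OptimalOnePlanar

theorem mainTheorem5 :
    ¬ OptimalOnePlanar.IsConfluent ∧
      OptimalOnePlanar.IsOptimal OptimalOnePlanar.G17 ∧
      OptimalOnePlanar.Reduces OptimalOnePlanar.G17 (OptimalOnePlanar.XW 5) ∧
      OptimalOnePlanar.Reduces OptimalOnePlanar.G17 (OptimalOnePlanar.XW 3) ∧
      OptimalOnePlanar.IsOptimal (OptimalOnePlanar.XW 5) ∧
      OptimalOnePlanar.IsOptimal (OptimalOnePlanar.XW 3) ∧
      OptimalOnePlanar.IsIrreducible (OptimalOnePlanar.XW 5) ∧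
      OptimalOnePlanar.IsIrreducible (OptimalOnePlanar.XW 3) :=
  ⟨OptimalOnePlanar.not_isConfluent, OptimalOnePlanar.isOptimal_G17,
    OptimalOnePlanar.reduces_G17_XW10, OptimalOnePlanar.reduces_G17_XW6,
    OptimalOnePlanar.isOptimal_XW10, OptimalOnePlanar.isOptimal_XW6,
    OptimalOnePlanar.isIrreducible_XW10, OptimalOnePlanar.isIrreducible_XW6⟩
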